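/- **Setting.** Let $\mathbb R^2_+=\{(T,p): T\ge 0,\ p\ge 0\}$, and let $\lambda_1,\lambda_2,a_1,a_2,b_1,b_2,b_3$ be continuous real functions of $(T,p)\in\mathbb R^2_+$ with $a_1,a_2,b_1,b_3>0$. For each $q=(T,p)\in\mathbb R^2_+$ consider, on the state space $\{(\rho_s,\rho_n)\in\mathbb R^2:\rho_s\ge 0\}$, the system $$\frac{d\rho_s}{dt}=\lambda_1\rho_s-a_1\rho_n\rho_s-a_2\rho_s^2,\qquad \frac{d\rho_n}{dt}=\lambda_2\rho_n-b_1\rho_s-b_2\rho_n^2-b_3\rho_n^3 ,$$ and write $u_q(t,\varphi)$, $t\ge 0$, for its solution with initial value $\varphi$. Let $D_1=\{q\in\mathbb R^2_+:\lambda_1(q)>0\}$, $D_2=\{q\in\mathbb R^2_+:\lambda_1(q)<0\}$, and, where $\lambda_2\neq 0$, $$A=\frac{a_1b_1}{|\lambda_2|}-a_2 .$$ **Definitions.** All neighborhoods and open dense sets below are relative to the state space. The state $0$ is *stable* at $q$ if it is an attractor, i.e. some neighborhood $U$ of $0$ satisfies $\sup_{\varphi\in U}\|u_q(t,\varphi)\|\to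 0$ as $t\to\infty$ (in particular the solutions starting in $U$ exist for all $t\ge0$); otherwise it is *unstable*. The system has a *superfluid transition* at $q_0$ from $D_2$ to $D_1$ if $q_0\in\overline{D_1}\cap\overline{D_2}$, the state $0$ is stable for all $q\in D_2$ close to $q_0$, and for all $q\in D_1$ close to $q_0$ the state $0$ is unstable and every initial value with $\rho_s(0)>0$ has a solution for all $t\geq 0$ which does not converge to $0$. Such a transition is * *Type-I (continuous)* if there are a neighborhood $U$ of $0$ and, for each $q\in\mathbb R^2_+$, an open dense subset $V_q$ of $U$ such that for every $\varepsilon>0$ and all $q\in\mathbb R^2_+$ close enough to $q_0$, one has $\limsup_{t\to\infty}\|u_q(t,\varphi)\|\le\varepsilon$ for all $\varphi\in V_q$; * *Type-II (jump)* if there are a neighborhood $U$ of $0$ and a $\delta>0$ such that for all $q\in D_1$ close enough to $q_0$ there is an open dense subset $V_q$ of $U$ with $\limsup_{t\to\infty}\|u_q(t,\varphi)\|\ge\delta$ for all $\varphi\in V_q$ (in both cases the solutions starting in $V_q$ exist for all $t\ge 0$). **Theorem.** (1) Let $q_0=(T_0,p_0)\in\mathbb R^2_+$ satisfy $\lambda_1(q_0)=0$,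 $\lambda_2(q_0)<0$ and $q_0\in\overline{D_1}\cap\overline{D_2}$. Then the system has a superfluid transition at $q_0$ from $D_2$ to $D_1$. If $A(q_0)<0$, the transition is Type-I; if $A(q_0)>0$, it is Type-II. (2) Let $CB$ be a simple arc $\gamma:[0,1]\to\mathbb R^2_+$ from $C=\gamma(0)$ to $B=\gamma(1)$, on which $\lambda_1=0$, with $\lambda_2(C)=0$, $\lambda_2<0$ on $CB\setminus\{C\}$, and $CB\setminus\{C\}\subset\overline{D_1}\cap\overline{D_2}$. Suppose that $a_1b_1<a_2|\lambda_2|$ at $B$. Then: * (a) The equation $A=0$ has a solution on $CB\setminus\{C\}$. More precisely, there are $0<s_1\le s_2<1$ with $A(\gamma(s_1))=A(\gamma(s_2))=0$ such that, for $0<s<s_1$, $A(\gamma(s))>0$ and there is a Type-II transition at $\gamma(s)$, and, for $s_2<s\le 1$, $A(\gamma(s))<0$ and there is a Type-I transition at $\gamma(s)$. * (b) Call $M=\gamma(s)$, $0<s<1$, a *switch point* if there is a Type-II transition at $\gamma(r)$ for all $0<r<s$ and a Type-I transition at $\gamma(r)$ for all $s<r\le1$. Every switch point satisfies $A=0$.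 * (c) If $A=0$ has exactly one solution $M$ on $CB\setminus\{C\}$, then $M$ is a switch point: the transition is Type-II at the points strictly between $C$ and $M$ and Type-I at the points after $M$ up to $B$. -/

import Mathlib

open Set Filter Topology

/-- The closed quadrant `ℝ²₊` of parameter values `q = (T, p)` (temperature, pressure). -/
def quadrant : Set (ℝ × ℝ) := {q | 0 ≤ q.1 ∧ 0 ≤ q.2}

/-- The state space of the system: pairs `z = (ρ_s, ρ_n)` with `ρ_s ≥ 0`. -/
def stateSpace : Set (ℝ × ℝ) := {z | 0 ≤ z.1}

/-- The nondimensional coefficients of the superfluidity system. They are functions of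
`q = (T, p)` that are continuous on `ℝ²₊`, and `a₁, a₂, b₁, b₃` are positive there. -/
structure Coefficients where
  lam1 : ℝ × ℝ → ℝ
  lam2 : ℝ × ℝ → ℝ
  a1 : ℝ × ℝ → ℝ
  a2 : ℝ × ℝ → ℝ
  b1 : ℝ × ℝ → ℝ
  b2 : ℝ × ℝ → ℝ
  b3 : ℝ × ℝ → ℝ
  continuousOn_lam1 : ContinuousOn lam1 quadrant
  continuousOn_lam2 : ContinuousOn lam2 quadrant
  continuousOn_a1 : ContinuousOn a1 quadrant
  continuousOn_a2 : ContinuousOn a2 quadrant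
  continuousOn_b1 : ContinuousOn b1 quadrant
  continuousOn_b2 : ContinuousOn b2 quadrant
  continuousOn_b3 : ContinuousOn b3 quadrant
  a1_pos : ∀ q ∈ quadrant, 0 < a1 q
  a2_pos : ∀ q ∈ quadrant, 0 < a2 q
  b1_pos : ∀ q ∈ quadrant, 0 < b1 q
  b3_pos : ∀ q ∈ quadrant, 0 < b3 q

namespace Coefficients

/-- The right-hand side of the system at `q = (T, p)` and `z = (ρ_s, ρ_n)`:
`dρ_s/dt = λ₁ρ_s - a₁ρ_nρ_s - a₂ρ_s²`, `dρ_n/dt = λ₂ρ_n - b₁ρ_s - b₂ρ_n² - b₃ρ_n³`. -/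
def field (c : Coefficients) (q z : ℝ × ℝ) : ℝ × ℝ :=
  (c.lam1 q * z.1 - c.a1 q * z.2 * z.1 - c.a2 q * z.1 ^ 2,
   c.lam2 q * z.2 - c.b1 q * z.1 - c.b2 q * z.2 ^ 2 - c.b3 q * z.2 ^ 3)

/-- `u` is a solution on `[0, ∞)`, with `ρ_s ≥ 0`, of the system at `q` with `u(0) = φ`. -/
def IsSolution (c : Coefficients) (q φ : ℝ × ℝ) (u : ℝ → ℝ × ℝ) : Prop :=
  u 0 = φ ∧ ∀ t, 0 ≤ t → u t ∈ stateSpace ∧ HasDerivWithinAt u (c.field q (u t)) (Ici 0) t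

/-- The solution of the system at `q` that starts from `φ` exists for all `t ≥ 0` and has the
property `P`. -/
def SolutionSatisfies (c : Coefficients) (q φ : ℝ × ℝ) (P : (ℝ → ℝ × ℝ) → Prop) : Prop :=
  (∃ u, c.IsSolution q φ u) ∧ ∀ u, c.IsSolution q φ u → P u

/-- The region `D₁`, where `λ₁ > 0`. -/
def D1 (c : Coefficients) : Set (ℝ × ℝ) := {q | q ∈ quadrant ∧ 0 < c.lam1 q}

/-- The region `D₂`, where `λ₁ < 0`. -/
def D2 (c : Coefficients) : Set (ℝ × ℝ) := {q | q ∈ quadrant ∧ c.lam1 q < 0}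

/-- The normal state `(ρ_s, ρ_n) = 0` is an attractor of the system at `q` in the state space:
it attracts some neighborhood of itself, uniformly. -/
def NormalStateStable (c : Coefficients) (q : ℝ × ℝ) : Prop :=
  ∃ U : Set (ℝ × ℝ), IsOpen U ∧ 0 ∈ U ∧ ∀ ε : ℝ, 0 < ε → ∃ t₀ : ℝ, 0 ≤ t₀ ∧
    ∀ φ ∈ stateSpace ∩ U, c.SolutionSatisfies q φ (fun u => ∀ t, t₀ ≤ t → ‖u t‖ < ε)

/-- The system has a superfluid transition at `q₀`, from `D₂` to `D₁`: both regions come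
arbitrarily close to `q₀`; for `q ∈ D₂` close to `q₀` the normal state is stable; and for
`q ∈ D₁` close to `q₀` it is unstable, the instability being carried by the superfluid component
(no solution with `ρ_s(0) > 0` returns to the normal state). -/
def HasSuperfluidTransition (c : Coefficients) (q₀ : ℝ × ℝ) : Prop :=
  q₀ ∈ closure c.D2 ∧ q₀ ∈ closure c.D1 ∧
  (∀ᶠ q in 𝓝[c.D2] q₀, c.NormalStateStable q) ∧
  (∀ᶠ q in 𝓝[c.D1] q₀, ¬ c.NormalStateStable q ∧
    ∀ φ : ℝ × ℝ, 0 < φ.1 →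
      c.SolutionSatisfies q φ (fun u => ¬ Tendsto u atTop (𝓝 0)))

/-- `V ∩ stateSpace` is a relatively open and dense subset of `U ∩ stateSpace`. -/
def IsOpenDenseIn (V U : Set (ℝ × ℝ)) : Prop :=
  IsOpen V ∧ V ⊆ U ∧ stateSpace ∩ U ⊆ closure (stateSpace ∩ V)

/-- Continuous (Type-I) dynamics at `q₀`: there are a neighborhood `U` of `0` and open dense
subsets `V q` of `U` such that `limsup_{t → ∞} ‖u_q(t, φ)‖ → 0` as `q → q₀`, for `φ ∈ V q`. -/
def IsContinuousAt (c : Coefficients) (q₀ : ℝ × ℝ) : Prop :=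
  ∃ U : Set (ℝ × ℝ), IsOpen U ∧ 0 ∈ U ∧ ∃ V : ℝ × ℝ → Set (ℝ × ℝ),
    (∀ q ∈ quadrant, IsOpenDenseIn (V q) U) ∧
    ∀ ε : ℝ, 0 < ε → ∀ᶠ q in 𝓝[quadrant] q₀, ∀ φ ∈ stateSpace ∩ V q,
      c.SolutionSatisfies q φ (fun u => limsup (fun t => ‖u t‖ₑ) atTop ≤ ENNReal.ofReal ε)

/-- Jump (Type-II) dynamics at `q₀`: there are a neighborhood `U` of `0` and a `δ > 0` such that
for all `q ∈ D₁` close to `q₀` there is an open dense subset `V` of `U` with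
`limsup_{t → ∞} ‖u_q(t, φ)‖ ≥ δ` for all `φ ∈ V`. -/
def IsJumpAt (c : Coefficients) (q₀ : ℝ × ℝ) : Prop :=
  ∃ U : Set (ℝ × ℝ), IsOpen U ∧ 0 ∈ U ∧ ∃ δ : ℝ, 0 < δ ∧
    ∀ᶠ q in 𝓝[c.D1] q₀, ∃ V : Set (ℝ × ℝ), IsOpenDenseIn V U ∧ ∀ φ ∈ stateSpace ∩ V,
      c.SolutionSatisfies q φ (fun u => ENNReal.ofReal δ ≤ limsup (fun t => ‖u t‖ₑ) atTop)

/-- The system has a superfluid transition at `q₀`, and it is Type-I (continuous). -/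
def HasTypeITransition (c : Coefficients) (q₀ : ℝ × ℝ) : Prop :=
  c.HasSuperfluidTransition q₀ ∧ c.IsContinuousAt q₀

/-- The system has a superfluid transition at `q₀`, and it is Type-II (jump). -/
def HasTypeIITransition (c : Coefficients) (q₀ : ℝ × ℝ) : Prop :=
  c.HasSuperfluidTransition q₀ ∧ c.IsJumpAt q₀

/-- The number `A = a₁b₁/|λ₂| - a₂`, meaningful where `λ₂ ≠ 0`. -/
noncomputable def A (c : Coefficients) (q : ℝ × ℝ) : ℝ :=
  c.a1 q * c.b1 q / |c.lam2 q| - c.a2 q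

/-- `γ : [0, 1] → ℝ²₊` parametrizes the coexistence curve `CB`: a simple arc of the curve
`λ₁ = 0`, along which `D₁` and `D₂` meet, that starts at the point `C = γ 0` where also `λ₂ = 0`,
and on the rest of which, up to `B = γ 1`, `λ₂ < 0`. -/
structure IsCurveCB (c : Coefficients) (γ : ℝ → ℝ × ℝ) : Prop where
  continuousOn : ContinuousOn γ (Icc 0 1)
  injOn : InjOn γ (Icc 0 1)
  mapsTo : MapsTo γ (Icc 0 1) quadrant
  lam1_eq_zero : ∀ s ∈ Icc (0 : ℝ) 1, c.lam1 (γ s) = 0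
  lam2_eq_zero : c.lam2 (γ 0) = 0
  lam2_neg : ∀ s ∈ Ioc (0 : ℝ) 1, c.lam2 (γ s) < 0
  mem_closure_D1 : ∀ s ∈ Ioc (0 : ℝ) 1, γ s ∈ closure c.D1
  mem_closure_D2 : ∀ s ∈ Ioc (0 : ℝ) 1, γ s ∈ closure c.D2

/-- `M = γ s` is a switch point of the curve `CB`: the transition is Type-II at every point
strictly between `C` and `M`, and Type-I at every point after `M` up to `B`. -/
def IsSwitchPoint (c : Coefficients) (γ : ℝ → ℝ × ℝ) (s : ℝ) : Prop :=
  s ∈ Ioo (0 : ℝ) 1 ∧ (∀ r ∈ Ioo 0 s, c.HasTypeIITransition (γ r)) ∧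
    ∀ r ∈ Ioc s 1, c.HasTypeITransition (γ r)

end Coefficients

/-!
Where `λ₁` is small and `λ₂ < 0`, the component `ρ_n` is slaved near `0` to `ρ_s`: to leading order
`ρ_n = -(b₁/|λ₂|) ρ_s`, which turns the first equation into `dρ_s/dt = λ₁ρ_s + A ρ_s²`. So for
`A < 0` the state settles at `ρ_s` about `λ₁/|A|` (at `0`, if `λ₁ ≤ 0`), while for `A > 0` and
`λ₁ > 0` it leaves a neighborhood of fixed size. Instead of reducing to a center manifold, the proof compares
solutions with explicit barriers, by the first-contact principle
`forall_neg_of_deriv_neg_at_contact`, using a slope `k` on the appropriate side of `b₁/|λ₂|`.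

* If `b₁/|λ₂| < k` and `a₁k < a₂`, the field points into all rectangles `{ρ_s ≤ m, |ρ_n| ≤ k m}`
  with `m` between some `e`, of the order of `λ₁`, and a fixed `r`; hence solutions enter the
  smallest one (`IsSolution.mem_shrinking_rectangle`). This gives Type-I. For `λ₁ < 0` and small
  `r` one may take `e = 0` without the condition on `a₂`, which gives stability of `0`.
* If `a₂ ≤ a₁k` and `k < b₁/|λ₂|`, then along a solution that stays in a small ball
  `ρ_n ≤ -k ρ_s` up to an exponentially small error, so the growth rate of `ρ_s` is eventually at
  least `λ₁/2 > 0` and the solution cannot stay (`IsSolution.exists_norm_gt`). This gives Type-II.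
* For every `λ₁ > 0`, near `0` the growth rate of `ρ_s` exceeds `λ₁/2`, so no solution with
  `ρ_s(0) > 0` tends to `0`.

Global solutions exist since large rectangles are forward invariant (`exists_isSolution`). On the
curve `CB` the sign of `A` is that of `a₁b₁ - a₂|λ₂|`, which is continuous up to `C` and positive
there; its first and last zeros delimit the two regimes. The two types exclude each other
(`not_isContinuousAt_and_isJumpAt`), so a switch point cannot lie where `A ≠ 0`.
-/

/-! ### Ordinary differential equations and comparison -/

/-- A bounded Lipschitz vector field has a solution on `[0, ∞)` through every point: by
Picard–Lindelöf there is one on each interval `[0, n]`, and these agree by uniqueness. -/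
theorem exists_forall_hasDerivWithinAt_Ici_of_lipschitz_of_bounded {E : Type*}
    [NormedAddCommGroup E] [NormedSpace ℝ E] [CompleteSpace E] {F : E → E} {K L : NNReal}
    (hF : LipschitzWith K F) (hL : ∀ x, ‖F x‖ ≤ L) (x₀ : E) :
    ∃ u : ℝ → E, u 0 = x₀ ∧ ∀ t, 0 ≤ t → HasDerivWithinAt u (F (u t)) (Ici 0) t := by
  have hex : ∀ n : ℕ, ∃ α : ℝ → E, α 0 = x₀ ∧
      ∀ t ∈ Icc (0 : ℝ) n, HasDerivWithinAt α (F (α t)) (Icc 0 n) t := by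
    intro n
    have h : IsPicardLindelof (fun _ => F) (⟨0, le_rfl, n.cast_nonneg⟩ : Icc (0 : ℝ) n) x₀
        (L * n) 0 L K :=
      .of_time_independent (fun x _ => hL x) hF.lipschitzOnWith (by simp)
    exact h.exists_eq_forall_mem_Icc_hasDerivWithinAt₀
  choose α hα0 hα using hex
  have hagree : ∀ {n m : ℕ}, n ≤ m → EqOn (α n) (α m) (Icc 0 n) := by
    intro n m hnm
    have hnm' : (n : ℝ) ≤ m := by exact_mod_cast hnm
    refine ODE_solution_unique (v := fun _ => F) (K := K) (fun _ => hF)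
      (fun t ht => (hα n t ht).continuousWithinAt) (fun t ht => ?_)
      (fun t ht => ((hα m t ⟨ht.1, ht.2.trans hnm'⟩).continuousWithinAt).mono
        (Icc_subset_Icc_right hnm')) (fun t ht => ?_) ((hα0 n).trans (hα0 m).symm)
    · exact (hα n t ⟨ht.1, ht.2.le⟩).mono_of_mem_nhdsWithin
        (Filter.mem_of_superset (Icc_mem_nhdsGE ht.2) (Icc_subset_Icc_left ht.1))
    · have htm : t < m := ht.2.trans_le hnm'
      exact (hα m t ⟨ht.1, htm.le⟩).mono_of_mem_nhdsWithin
        (Filter.mem_of_superset (Icc_mem_nhdsGE htm) (Icc_subset_Icc_left ht.1))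
  have hu : ∀ {N : ℕ} {s : ℝ}, 0 ≤ s → s < N → α (⌊s⌋₊ + 1) s = α N s := by
    intro N s hs hsN
    exact hagree (Nat.succ_le_of_lt ((Nat.floor_lt hs).2 hsN))
      ⟨hs, by exact_mod_cast (Nat.lt_floor_add_one s).le⟩
  refine ⟨fun s => α (⌊s⌋₊ + 1) s, by simpa using hα0 1, fun t ht => ?_⟩
  have htN : t < ((⌊t⌋₊ + 1 : ℕ) : ℝ) := by exact_mod_cast Nat.lt_floor_add_one t
  have hd := (hα (⌊t⌋₊ + 1) t ⟨ht, htN.le⟩)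
  have hmem : Icc (0 : ℝ) ((⌊t⌋₊ + 1 : ℕ) : ℝ) ∈ 𝓝[Ici 0] t := by
    rw [← Ici_inter_Iic]
    exact inter_mem self_mem_nhdsWithin (mem_nhdsWithin_of_mem_nhds (Iic_mem_nhds htN))
  refine (hd.mono_of_mem_nhdsWithin hmem).congr_of_eventuallyEq ?_ rfl
  filter_upwards [self_mem_nhdsWithin, mem_nhdsWithin_of_mem_nhds (Iio_mem_nhds htN)] with s hs hsN
  exact hu hs hsN

/-- Comparison by first contact: finitely many functions that start out negative stay negative
if, at every time at which all are `≤ 0`, each one that vanishes has negative derivative. -/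
theorem forall_neg_of_deriv_neg_at_contact {ι : Type*} [Finite ι] {g g' : ι → ℝ → ℝ}
    (hg : ∀ i t, 0 ≤ t → HasDerivWithinAt (g i) (g' i t) (Ici 0) t)
    (h0 : ∀ i, g i 0 < 0)
    (hcontact : ∀ t, 0 < t → (∀ j, g j t ≤ 0) → ∀ i, g i t = 0 → g' i t < 0) :
    ∀ t, 0 ≤ t → ∀ i, g i t < 0 := by
  by_contra! ⟨t₁, ht₁, i₁, hi₁⟩
  have hcont : ∀ i, ContinuousOn (g i) (Icc 0 t₁) := fun i t ht =>
    ((hg i t ht.1).continuousWithinAt).mono fun _ hs => hs.1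
  have hcompact : IsCompact (⋃ i, Icc 0 t₁ ∩ g i ⁻¹' Ici 0) := by
    refine isCompact_iUnion fun i => ?_
    exact isCompact_Icc.of_isClosed_subset
      ((hcont i).preimage_isClosed_of_isClosed isClosed_Icc isClosed_Ici) inter_subset_left
  obtain ⟨t₀, ht₀, hleast⟩ := hcompact.exists_isLeast
    ⟨t₁, mem_iUnion.2 ⟨i₁, ⟨ht₁, le_rfl⟩, hi₁⟩⟩
  obtain ⟨i, ht₀I, hi⟩ := mem_iUnion.1 ht₀
  have hi : 0 ≤ g i t₀ := hi
  have hpos : 0 < t₀ := by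
    rcases ht₀I.1.eq_or_lt with h | h
    · exact absurd hi (not_le.2 (h ▸ h0 i))
    · exact h
  have hbefore : ∀ j, ∀ s, 0 ≤ s → s < t₀ → g j s < 0 := by
    intro j s hs hst
    by_contra! hcon
    exact absurd (hleast (mem_iUnion.2 ⟨j, ⟨hs, hst.le.trans ht₀I.2⟩, hcon⟩)) (not_le.2 hst)
  have hev : ∀ᶠ s in 𝓝[<] t₀, 0 ≤ s ∧ s < t₀ := by
    filter_upwards [self_mem_nhdsWithin, mem_nhdsWithin_of_mem_nhds (Ici_mem_nhds hpos)]
      with s h1 h2 using ⟨h2, h1⟩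
  have hderiv : ∀ j, HasDerivAt (g j) (g' j t₀) t₀ := fun j =>
    (hg j t₀ hpos.le).hasDerivAt (Ici_mem_nhds hpos)
  have hle : ∀ j, g j t₀ ≤ 0 := fun j =>
    le_of_tendsto ((hderiv j).continuousAt.tendsto.mono_left (nhdsWithin_le_nhds (s := Iio t₀)))
      (hev.mono fun s hs => (hbefore j s hs.1 hs.2).le)
  have hzero : g i t₀ = 0 := le_antisymm (hle i) hi
  have hslope : Tendsto (slope (g i) t₀) (𝓝[<] t₀) (𝓝 (g' i t₀)) :=
    (hasDerivAt_iff_tendsto_slope.1 (hderiv i)).mono_left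
      (nhdsWithin_mono _ fun s hs => ne_of_lt hs)
  refine absurd (ge_of_tendsto hslope (hev.mono fun s hs => ?_))
    (not_le.2 (hcontact t₀ hpos hle i hzero))
  rw [slope_def_field, hzero, sub_zero]
  exact div_nonneg_of_nonpos (hbefore i s hs.1 hs.2).le (by linarith [hs.2])

/-- The differential inequality `f' ≥ c f` gives exponential growth. -/
theorem mul_exp_le_of_mul_le_deriv {f f' : ℝ → ℝ} {a b c : ℝ} (ha : 0 ≤ a) (hab : a ≤ b)
    (hf : ∀ t, 0 ≤ t → HasDerivWithinAt f (f' t) (Ici 0) t)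
    (h : ∀ t ∈ Ioo a b, c * f t ≤ f' t) :
    f a * Real.exp (c * (b - a)) ≤ f b := by
  have hmono : MonotoneOn (fun t => f t * Real.exp (-(c * t))) (Icc a b) := by
    refine monotoneOn_of_hasDerivWithinAt_nonneg (convex_Icc a b)
      (f' := fun t => f' t * Real.exp (-(c * t)) + f t * (Real.exp (-(c * t)) * (-(c * 1)))) ?_ ?_ ?_
    · refine ContinuousOn.mul (fun t ht => ?_) (by fun_prop)
      exact ((hf t (ha.trans ht.1)).continuousWithinAt).mono fun s hs => ha.trans hs.1
    · intro t ht
      rw [interior_Icc] at ht ⊢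
      refine HasDerivWithinAt.mul ((hf t (ha.trans ht.1.le)).mono fun s hs => ha.trans hs.1.le) ?_
      exact (((hasDerivAt_id t).const_mul c).neg.exp).hasDerivWithinAt
    · intro t ht
      rw [interior_Icc] at ht
      have := h t ht
      have he := Real.exp_pos (-(c * t))
      nlinarith
  have := hmono (left_mem_Icc.2 hab) (right_mem_Icc.2 hab) hab
  simp only at this
  calc f a * Real.exp (c * (b - a))
      = f a * Real.exp (-(c * a)) * Real.exp (c * b) := by
        rw [mul_assoc, ← Real.exp_add]; ring_nf
    _ ≤ f b * Real.exp (-(c * b)) * Real.exp (c * b) := by gcongr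
    _ = f b := by rw [mul_assoc, ← Real.exp_add]; simp

/-! ### Zeros of a continuous function on an interval -/

/-- A continuous function on `[0, 1]` that is positive at `0` and negative at `1` has a first and
a last zero; it is positive before the first one and negative after the last one. -/
theorem exists_first_last_zero {h : ℝ → ℝ} (hc : ContinuousOn h (Icc 0 1)) (h0 : 0 < h 0)
    (h1 : h 1 < 0) :
    ∃ s₁ s₂, 0 < s₁ ∧ s₁ ≤ s₂ ∧ s₂ < 1 ∧ h s₁ = 0 ∧ h s₂ = 0 ∧
      (∀ s ∈ Ioo 0 s₁, 0 < h s) ∧ ∀ s ∈ Ioc s₂ 1, h s < 0 := by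
  have hcompact : IsCompact (Icc 0 1 ∩ h ⁻¹' {0}) :=
    isCompact_Icc.of_isClosed_subset
      (hc.preimage_isClosed_of_isClosed isClosed_Icc isClosed_singleton) inter_subset_left
  have hne : (Icc 0 1 ∩ h ⁻¹' {0}).Nonempty := by
    obtain ⟨s, hs, hs0⟩ := intermediate_value_Icc' zero_le_one hc ⟨h1.le, h0.le⟩
    exact ⟨s, hs, hs0⟩
  obtain ⟨s₁, ⟨hs₁, hz₁⟩, hmin⟩ := hcompact.exists_isLeast hne
  obtain ⟨s₂, ⟨hs₂, hz₂⟩, hmax⟩ := hcompact.exists_isGreatest hne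
  have hz₁ : h s₁ = 0 := hz₁
  have hz₂ : h s₂ = 0 := hz₂
  refine ⟨s₁, s₂, hs₁.1.lt_of_ne ?_, hmin ⟨hs₂, hz₂⟩, hs₂.2.lt_of_ne ?_, hz₁, hz₂, ?_, ?_⟩
  · rintro rfl
    exact h0.ne' hz₁
  · rintro rfl
    exact h1.ne hz₂
  · intro s hs
    by_contra! hle
    obtain ⟨z, hz, hz0⟩ := intermediate_value_Icc' hs.1.le
      (hc.mono (Icc_subset_Icc_right (hs.2.le.trans hs₁.2))) ⟨hle, h0.le⟩
    exact absurd (hmin ⟨⟨hz.1, hz.2.trans (hs.2.le.trans hs₁.2)⟩, hz0⟩)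
      (not_le.2 (hz.2.trans_lt hs.2))
  · intro s hs
    by_contra! hle
    obtain ⟨z, hz, hz0⟩ := intermediate_value_Icc' hs.2
      (hc.mono (Icc_subset_Icc_left (hs₂.1.trans hs.1.le))) ⟨h1.le, hle⟩
    exact absurd (hmax ⟨⟨(hs₂.1.trans hs.1.le).trans hz.1, hz.2⟩, hz0⟩)
      (not_le.2 (hs.1.trans_le hz.1))

namespace Coefficients

variable {c : Coefficients} {q q₀ φ : ℝ × ℝ} {u : ℝ → ℝ × ℝ}

/-! ### Solutions of the system and their global existence -/

theorem IsSolution.fst_nonneg (hu : c.IsSolution q φ u) {t : ℝ} (ht : 0 ≤ t) : 0 ≤ (u t).1 :=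
  (hu.2 t ht).1

theorem IsSolution.hasDerivWithinAt_fst (hu : c.IsSolution q φ u) {t : ℝ} (ht : 0 ≤ t) :
    HasDerivWithinAt (fun t => (u t).1) (c.field q (u t)).1 (Ici 0) t := by
  have h := (hu.2 t ht).2.hasFDerivWithinAt.fst.hasDerivWithinAt
  simpa using! h

theorem IsSolution.hasDerivWithinAt_snd (hu : c.IsSolution q φ u) {t : ℝ} (ht : 0 ≤ t) :
    HasDerivWithinAt (fun t => (u t).2) (c.field q (u t)).2 (Ici 0) t := by
  have h := (hu.2 t ht).2.hasFDerivWithinAt.snd.hasDerivWithinAt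
  simpa using! h

theorem IsSolution.shift (hu : c.IsSolution q φ u) {t₀ : ℝ} (ht₀ : 0 ≤ t₀) :
    c.IsSolution q (u t₀) (fun t => u (t + t₀)) := by
  refine ⟨by simp, fun t ht => ⟨(hu.2 _ (by positivity)).1, ?_⟩⟩
  have h := (hu.2 (t + t₀) (by positivity)).2
  have h2 : HasDerivWithinAt (fun s : ℝ => s + t₀) 1 (Ici 0) t :=
    ((hasDerivAt_id t).add_const t₀).hasDerivWithinAt
  simpa [Function.comp_def] using!
    HasDerivWithinAt.scomp t h h2 (fun s hs => add_nonneg hs ht₀)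

/-- Every initial state has a solution on `[0, ∞)`. For large `R` the field points into the
rectangle `[0, KR] × [-R, R]`, where `a₂ K = a₁ + a₂`, so a solution of the bounded Lipschitz
field obtained by clamping the state to this rectangle stays in it and solves the system. -/
theorem exists_isSolution (hq : q ∈ quadrant) (hφ : φ ∈ stateSpace) :
    ∃ u, c.IsSolution q φ u := by
  have ha1 := c.a1_pos q hq
  have ha2 := c.a2_pos q hq
  have hb1 := c.b1_pos q hq
  have hb3 := c.b3_pos q hq
  obtain ⟨K, hK, hK0⟩ : ∃ K, c.a2 q * K = c.a1 q + c.a2 q ∧ 0 < K :=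
    ⟨(c.a1 q + c.a2 q) / c.a2 q, by field_simp, by positivity⟩
  obtain ⟨R, hR1, hRφ1, hRφ2, hRx, hRy⟩ : ∃ R : ℝ, 1 ≤ R ∧ φ.1 < K * R ∧ |φ.2| < R ∧
      c.lam1 q < c.a2 q * R ∧ |c.lam2 q| + c.b1 q * K + |c.b2 q| < c.b3 q * R := by
    have htop : ∀ {α : ℝ}, 0 < α → Tendsto (fun R => α * R) atTop atTop := fun h =>
      tendsto_id.const_mul_atTop h
    exact ((eventually_ge_atTop (1 : ℝ)).and (((htop hK0).eventually_gt_atTop φ.1).and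
      ((eventually_gt_atTop |φ.2|).and (((htop ha2).eventually_gt_atTop _).and
        ((htop hb3).eventually_gt_atTop _))))).exists
  have hR0 : 0 < R := by linarith
  have hKR : 0 ≤ K * R := by positivity
  -- At `ρ_n = ±R` the cubic term dominates all others, for every `ρ_s ∈ [0, KR]`.
  have hcubic : ∀ x, 0 ≤ x → x ≤ K * R →
      |c.lam2 q| * R + c.b1 q * x + |c.b2 q| * R ^ 2 < c.b3 q * R ^ 3 := by
    intro x _ hx
    have h1 : c.b1 q * x ≤ c.b1 q * (K * R) := by gcongr
    have hR2 : R ≤ R ^ 2 := by nlinarith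
    have h2 : |c.lam2 q| * R ≤ |c.lam2 q| * R ^ 2 := by gcongr
    have h3 : c.b1 q * K * R ≤ c.b1 q * K * R ^ 2 := by gcongr
    have h4 := mul_lt_mul_of_pos_right hRy (by positivity : 0 < R ^ 2)
    nlinarith
  set P : ℝ × ℝ → ℝ × ℝ := fun z => (max 0 (min z.1 (K * R)), max (-R) (min z.2 R)) with hP
  have hPmem : ∀ z, P z ∈ Icc 0 (K * R) ×ˢ Icc (-R) R := fun z =>
    ⟨⟨le_max_left _ _, max_le hKR (min_le_right _ _)⟩,
      ⟨le_max_left _ _, max_le (by linarith) (min_le_right _ _)⟩⟩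
  have hPlip : LipschitzWith (max 1 1) P :=
    ((LipschitzWith.prod_fst.min_const (K * R)).const_max 0).prodMk
      ((LipschitzWith.prod_snd.min_const R).const_max (-R))
  have hcompact : IsCompact (Icc 0 (K * R) ×ˢ Icc (-R) R) := isCompact_Icc.prod isCompact_Icc
  have hsmooth : ContDiff ℝ 1 (c.field q) := by
    unfold field
    fun_prop
  obtain ⟨C, hC⟩ := hsmooth.contDiffOn.exists_lipschitzOnWith one_ne_zero
    ((convex_Icc 0 (K * R)).prod (convex_Icc (-R) R)) hcompact
  obtain ⟨L, hL⟩ := hcompact.exists_bound_of_continuousOn hsmooth.continuous.continuousOn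
  have hlip : LipschitzWith (C * max 1 1) (fun z => c.field q (P z)) := by
    rw [← lipschitzOnWith_univ] at hPlip ⊢
    exact hC.comp hPlip fun z _ => hPmem z
  obtain ⟨u, hu0, hu⟩ := exists_forall_hasDerivWithinAt_Ici_of_lipschitz_of_bounded
    (L := L.toNNReal) hlip (fun z => (hL _ (hPmem z)).trans (Real.le_coe_toNNReal L)) φ
  have hx : ∀ t, 0 ≤ t →
      HasDerivWithinAt (fun t => (u t).1) (c.field q (P (u t))).1 (Ici 0) t := fun t ht => by
    simpa using! (hu t ht).hasFDerivWithinAt.fst.hasDerivWithinAt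
  have hy : ∀ t, 0 ≤ t →
      HasDerivWithinAt (fun t => (u t).2) (c.field q (P (u t))).2 (Ici 0) t := fun t ht => by
    simpa using! (hu t ht).hasFDerivWithinAt.snd.hasDerivWithinAt
  -- The first component of the clamped field is `0`, not positive, for `ρ_s ≤ 0`, so contact is
  -- excluded only with the strictly decreasing barrier `-ε (1 + t)`.
  have hx0 : ∀ t, 0 ≤ t → 0 ≤ (u t).1 := by
    intro t ht
    refine le_of_forall_pos_lt_add fun ε hε => ?_
    have hδ : 0 < ε / (1 + t) := by positivity
    have := forall_neg_of_deriv_neg_at_contact (ι := Unit)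
      (g := fun _ s => -(u s).1 - ε / (1 + t) * (1 + s))
      (g' := fun _ s => -(c.field q (P (u s))).1 - ε / (1 + t) * 1)
      (fun _ s hs => ((hx s hs).neg).sub
        ((((hasDerivAt_id s).const_add 1).const_mul _).hasDerivWithinAt))
      (fun _ => by
        have : 0 ≤ φ.1 := hφ
        simp only [hu0]; linarith)
      (fun s hs _ _ hs0 => by
        have hneg : (u s).1 ≤ 0 := by
          have : 0 < ε / (1 + t) * (1 + s) := by positivity
          linarith
        have hP1 : (P (u s)).1 = 0 := max_eq_left ((min_le_left _ _).trans hneg)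
        simp only [field, hP1]
        linarith) t ht ()
    field_simp at this
    linarith
  have hrect : ∀ t, 0 ≤ t → ∀ i : Fin 3,
      ![fun s => (u s).1 - K * R, fun s => (u s).2 - R, fun s => -(u s).2 - R] i t < 0 := by
    refine forall_neg_of_deriv_neg_at_contact
      (g' := ![fun s => (c.field q (P (u s))).1, fun s => (c.field q (P (u s))).2,
        fun s => -(c.field q (P (u s))).2]) ?_ ?_ ?_
    · intro i t ht
      fin_cases i
      · exact (hx t ht).sub_const _
      · exact (hy t ht).sub_const _
      · exact (hy t ht).neg.sub_const _
    · intro i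
      have := abs_lt.1 hRφ2
      fin_cases i <;> simp [hu0] <;> linarith
    · intro t ht _ i hi
      obtain ⟨⟨hX0, hX1⟩, hY0, hY1⟩ := hPmem (u t)
      have hb2 := abs_le.1 (le_refl |c.b2 q|)
      have hl2 := abs_le.1 (le_refl |c.lam2 q|)
      have hc := hcubic _ hX0 hX1
      have e1 := mul_le_mul_of_nonneg_right hb2.1 (sq_nonneg R)
      have e2 := mul_le_mul_of_nonneg_right hb2.2 (sq_nonneg R)
      have e3 := mul_le_mul_of_nonneg_right hl2.1 hR0.le
      have e4 := mul_le_mul_of_nonneg_right hl2.2 hR0.le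
      have e5 := mul_nonneg hb1.le hX0
      fin_cases i
      · have hX : (P (u t)).1 = K * R := by
          have : (u t).1 = K * R := by simpa [sub_eq_zero] using hi
          simp [hP, this, hKR]
        simp only [Fin.zero_eta, Matrix.cons_val_zero, field, hX]
        have h1 : 0 ≤ c.a1 q * ((P (u t)).2 + R) := mul_nonneg ha1.le (by linarith)
        have h2 : c.lam1 q - c.a1 q * (P (u t)).2 - c.a2 q * (K * R) < 0 := by
          have : c.a2 q * (K * R) = (c.a1 q + c.a2 q) * R := by rw [← hK]; ring
          nlinarith
        have h3 : 0 < K * R := by positivity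
        nlinarith [mul_pos_of_neg_of_neg h2 (neg_lt_zero.2 h3)]
      · have hY : (P (u t)).2 = R := by
          have : (u t).2 = R := by simpa [sub_eq_zero] using hi
          simp only [hP, this, min_self]
          exact max_eq_right (by linarith)
        simp only [Fin.mk_one, Matrix.cons_val_one, Matrix.cons_val_zero, field, hY]
        linarith
      · have hY : (P (u t)).2 = -R := by
          have : (u t).2 = -R := by
            have : -(u t).2 - R = 0 := by simpa using hi
            linarith
          simp only [hP, this]
          exact max_eq_left (min_le_left _ _)
        simp only [Fin.reduceFinMk, Matrix.cons_val, field, hY]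
        linarith
  refine ⟨u, hu0, fun t ht => ⟨hx0 t ht, ?_⟩⟩
  have h0 : (u t).1 < K * R := by simpa using hrect t ht 0
  have h1 : (u t).2 < R := by simpa using hrect t ht 1
  have h2 : -R < (u t).2 := by
    have : -(u t).2 - R < 0 := by simpa using hrect t ht 2
    linarith
  have hPu : P (u t) = u t := by
    ext
    · simp [hP, h0.le, hx0 t ht]
    · simp [hP, h1.le, h2.le]
  have := hu t ht
  rwa [hPu] at this

/-! ### Shrinking rectangles -/

/-- If the field points into the rectangles `{ρ_s ≤ m, |ρ_n| ≤ k m}` for `m ∈ [e, r]`, at relative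
rate `ν`, then a solution starting in the largest of them is shrunk to the smallest one
exponentially fast. -/
theorem IsSolution.mem_shrinking_rectangle (hu : c.IsSolution q φ u) (hq : q ∈ quadrant)
    {k ν e r : ℝ} (hk : 0 < k) (hν : 0 < ν) (he : 0 ≤ e) (her : e ≤ r) (hr : 0 < r)
    (hx : ∀ m, e ≤ m → m ≤ r → c.lam1 q + (c.a1 q * k - c.a2 q) * m < -ν)
    (hy : c.lam2 q * k + c.b1 q + |c.b2 q| * k ^ 2 * r < -(ν * k))
    (h1 : φ.1 < r) (h2 : |φ.2| < k * r) {t : ℝ} (ht : 0 ≤ t) :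
    (u t).1 < e + (r - e) * Real.exp (-(ν * t)) ∧
      |(u t).2| < k * (e + (r - e) * Real.exp (-(ν * t))) := by
  have ha1 := c.a1_pos q hq
  have hb1 := c.b1_pos q hq
  have hb3 := c.b3_pos q hq
  set B : ℝ → ℝ := fun t => e + (r - e) * Real.exp (-(ν * t)) with hBdef
  set B' : ℝ → ℝ := fun t => (r - e) * (Real.exp (-(ν * t)) * (-(ν * 1))) with hB'def
  have hB : ∀ t, HasDerivWithinAt B (B' t) (Ici 0) t := fun t =>
    (((((hasDerivAt_id t).const_mul ν).neg.exp).const_mul (r - e)).const_add e).hasDerivWithinAt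
  have hB0 : B 0 = r := by simp [hBdef]
  have hBe : ∀ t, e ≤ B t := fun t =>
    le_add_of_nonneg_right (mul_nonneg (by linarith) (Real.exp_pos _).le)
  have hBpos : ∀ t, 0 < B t := by
    intro t
    rcases he.eq_or_lt with h | h
    · simp only [hBdef, ← h, sub_zero, zero_add]
      positivity
    · exact h.trans_le (hBe t)
  have hBr : ∀ t, 0 ≤ t → B t ≤ r := by
    intro t ht
    have h1 : Real.exp (-(ν * t)) ≤ 1 := Real.exp_le_one_iff.2 (by nlinarith)
    have := mul_le_mul_of_nonneg_left h1 (by linarith : 0 ≤ r - e)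
    simp only [hBdef]
    linarith
  have hB'le : ∀ t, -(ν * B t) ≤ B' t := by
    intro t
    have : B' t = -(ν * (B t - e)) := by simp only [hBdef, hB'def]; ring
    rw [this]
    nlinarith
  have key : ∀ t, 0 ≤ t → ∀ i : Fin 3, ![fun s => (u s).1 - B s,
      fun s => (u s).2 - k * B s, fun s => -(u s).2 - k * B s] i t < 0 := by
    refine forall_neg_of_deriv_neg_at_contact
      (g' := ![fun s => (c.field q (u s)).1 - B' s, fun s => (c.field q (u s)).2 - k * B' s,
        fun s => -(c.field q (u s)).2 - k * B' s]) ?_ ?_ ?_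
    · intro i t ht
      fin_cases i
      · exact (hu.hasDerivWithinAt_fst ht).sub (hB t)
      · exact (hu.hasDerivWithinAt_snd ht).sub ((hB t).const_mul k)
      · exact (hu.hasDerivWithinAt_snd ht).neg.sub ((hB t).const_mul k)
    · intro i
      have := abs_lt.1 h2
      fin_cases i <;> simp [hu.1, hB0] <;> linarith
    · intro t ht hall i hi
      have hx0 := hu.fst_nonneg ht.le
      have hle1 : (u t).1 ≤ B t := by simpa using hall 0
      have hle3 : -(k * B t) ≤ (u t).2 := by
        have : -(u t).2 - k * B t ≤ 0 := by simpa using hall 2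
        linarith
      have hp := hBpos t
      have hd := hB'le t
      have hb2 := abs_le.1 (le_refl |c.b2 q|)
      have hkd : -(k * (ν * B t)) ≤ k * B' t := by nlinarith
      -- the inward condition on the sides `ρ_n = ±km`, multiplied by `m = B t`
      have hyB : c.lam2 q * (k * B t) + c.b1 q * B t + |c.b2 q| * (k * B t) ^ 2
          < -(k * (ν * B t)) := by
        have e1 := mul_lt_mul_of_pos_right hy hp
        have e2 : |c.b2 q| * k ^ 2 * B t * B t ≤ |c.b2 q| * k ^ 2 * r * B t := by
          gcongr
          exact hBr t ht.le
        linarith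
      have e3 : 0 < c.b3 q * (k * B t) ^ 3 := by positivity
      have e4 := mul_le_mul_of_nonneg_right hb2.1 (sq_nonneg (k * B t))
      have e5 := mul_le_mul_of_nonneg_right hb2.2 (sq_nonneg (k * B t))
      have e6 : c.b1 q * (u t).1 ≤ c.b1 q * B t := by gcongr
      have e7 := mul_nonneg hb1.le hx0
      fin_cases i
      · have hX : (u t).1 = B t := by simpa [sub_eq_zero] using hi
        simp only [Fin.zero_eta, Matrix.cons_val_zero, field, hX]
        have e1 := mul_lt_mul_of_pos_right (hx (B t) (hBe t) (hBr t ht.le)) hp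
        have e2 : 0 ≤ c.a1 q * ((u t).2 + k * B t) * B t :=
          mul_nonneg (mul_nonneg ha1.le (by linarith)) hp.le
        linarith
      · have hY : (u t).2 = k * B t := by simpa [sub_eq_zero] using hi
        simp only [Fin.mk_one, Matrix.cons_val_one, Matrix.cons_val_zero, field, hY]
        linarith
      · have hY : (u t).2 = -(k * B t) := by
          have : -(u t).2 - k * B t = 0 := by simpa using hi
          linarith
        simp only [Fin.reduceFinMk, Matrix.cons_val, field, hY]
        linarith
  have k0 : (u t).1 < B t := by simpa using key t ht 0
  have k1 : (u t).2 < k * B t := by simpa using key t ht 1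
  have k2 : -(u t).2 - k * B t < 0 := by simpa using key t ht 2
  exact ⟨k0, abs_lt.2 ⟨by linarith, k1⟩⟩

/-! ### Growth of the superfluid component -/

/-- The growth rate `λ₁ - a₁ρ_n - a₂ρ_s` of the superfluid component `ρ_s`. -/
def growthRate (c : Coefficients) (q z : ℝ × ℝ) : ℝ := c.lam1 q - c.a1 q * z.2 - c.a2 q * z.1

theorem field_fst (c : Coefficients) (q z : ℝ × ℝ) :
    (c.field q z).1 = c.growthRate q z * z.1 := by
  simp only [field, growthRate]
  ring

/-- A solution with `ρ_s(0) > 0` has `ρ_s > 0` at all times. -/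
theorem IsSolution.fst_pos (hu : c.IsSolution q φ u) (hφ : 0 < φ.1) {t : ℝ} (ht : 0 ≤ t) :
    0 < (u t).1 := by
  have hcont : ContinuousOn (fun s => c.growthRate q (u s)) (Icc 0 t) := by
    have hu' : ContinuousOn u (Icc 0 t) := fun s hs =>
      ((hu.2 s hs.1).2.continuousWithinAt).mono fun _ h => h.1
    unfold growthRate
    fun_prop
  obtain ⟨m, hm⟩ := (isCompact_Icc.image_of_continuousOn hcont).bddBelow
  have h := mul_exp_le_of_mul_le_deriv (c := m) le_rfl ht
    (fun s hs => hu.hasDerivWithinAt_fst hs) (fun s hs => by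
      rw [field_fst]
      exact mul_le_mul_of_nonneg_right (hm (mem_image_of_mem _ (Ioo_subset_Icc_self hs)))
        (hu.fst_nonneg hs.1.le))
  rw [hu.1] at h
  exact lt_of_lt_of_le (by positivity) h

/-- If the growth rate of `ρ_s > 0` is eventually bounded below by a positive number, then `ρ_s`
is unbounded. -/
theorem IsSolution.not_bounded_of_growthRate (hu : c.IsSolution q φ u) (hφ : 0 < φ.1) {ν C : ℝ}
    (hν : 0 < ν) (hrate : ∀ᶠ t in atTop, ν ≤ c.growthRate q (u t))
    (hC : ∀ᶠ t in atTop, (u t).1 ≤ C) : False := by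
  obtain ⟨T, hT⟩ := (hrate.and (hC.and (eventually_ge_atTop 0))).exists_forall_of_atTop
  have hT0 : 0 ≤ T := (hT T le_rfl).2.2
  have hlow : ∀ t, T ≤ t → (u T).1 * Real.exp (ν * (t - T)) ≤ (u t).1 := fun t ht =>
    mul_exp_le_of_mul_le_deriv hT0 ht (fun s hs => hu.hasDerivWithinAt_fst hs) fun s hs => by
      rw [field_fst]
      exact mul_le_mul_of_nonneg_right (hT s hs.1.le).1 (hu.fst_nonneg (hT0.trans hs.1.le))
  have htop : Tendsto (fun t => (u T).1 * Real.exp (ν * (t - T))) atTop atTop :=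
    ((Real.tendsto_exp_atTop.comp ((tendsto_atTop_add_const_right _ (-T) tendsto_id).const_mul_atTop
      hν)).const_mul_atTop (hu.fst_pos hφ hT0))
  obtain ⟨t, ht, htT⟩ := ((htop.eventually_gt_atTop C).and (eventually_ge_atTop T)).exists
  linarith [hlow t htT, (hT t htT).2.1]

/-- For `λ₁ > 0` no solution with `ρ_s(0) > 0` tends to `0`, since `ρ_s` grows near `0`. -/
theorem IsSolution.not_tendsto_zero (hu : c.IsSolution q φ u) (hφ : 0 < φ.1)
    (hlam : 0 < c.lam1 q) : ¬ Tendsto u atTop (𝓝 0) := by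
  intro h
  have hcont : Continuous (c.growthRate q) := by unfold growthRate; fun_prop
  have hrate := (hcont.tendsto 0).comp h
  have h0 : c.lam1 q / 2 < c.growthRate q 0 := by simp [growthRate]; linarith
  refine hu.not_bounded_of_growthRate hφ (half_pos hlam) (C := 1)
    ((hrate.eventually_const_lt h0).mono fun t ht => ht.le) ?_
  have h1 := (continuous_fst.tendsto (0 : ℝ × ℝ)).comp h
  exact (h1.eventually_lt_const (show (0 : ℝ × ℝ).1 < 1 by simp)).mono fun t ht => ht.le

/-- If `k` is smaller than the slope `b₁/|λ₂|` of the slow manifold, then `-ρ_n ≥ k ρ_s` up to an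
exponentially small error along a solution that stays in a small ball. -/
theorem IsSolution.add_snd_lt_exp (hu : c.IsSolution q φ u) (hq : q ∈ quadrant)
    {k ν δ G : ℝ} (hk : 0 < k) (hδ : δ ≤ 1) (hG : 0 < G)
    (hx : k * (c.lam1 q + c.a1 q * δ + (|c.b2 q| + |c.b3 q|) * δ) ≤ c.lam2 q * k + c.b1 q)
    (hy : c.lam2 q + (|c.b2 q| + |c.b3 q|) * δ < -ν)
    (hball : ∀ t, 0 ≤ t → ‖u t‖ ≤ δ) (h0 : k * φ.1 + φ.2 < G) {t : ℝ} (ht : 0 ≤ t) :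
    k * (u t).1 + (u t).2 < G * Real.exp (-(ν * t)) := by
  have ha1 := c.a1_pos q hq
  have ha2 := c.a2_pos q hq
  have key := forall_neg_of_deriv_neg_at_contact (ι := Unit)
    (g := fun _ s => k * (u s).1 + (u s).2 - G * Real.exp (-(ν * s)))
    (g' := fun _ s => k * (c.field q (u s)).1 + (c.field q (u s)).2
      - G * (Real.exp (-(ν * s)) * (-(ν * 1))))
    (fun _ s hs => (((hu.hasDerivWithinAt_fst hs).const_mul k).add
      (hu.hasDerivWithinAt_snd hs)).sub
      ((((hasDerivAt_id s).const_mul ν).neg.exp).const_mul G).hasDerivWithinAt)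
    (fun _ => by simp [hu.1]; linarith)
    (fun s hs _ _ hs0 => by
      have hB : 0 < G * Real.exp (-(ν * s)) := by positivity
      have hx0 := hu.fst_nonneg hs.le
      have hyδ : |(u s).2| ≤ δ := (norm_snd_le (u s)).trans (hball s hs.le)
      simp only [field]
      have hB' : G * (Real.exp (-(ν * s)) * (-(ν * 1))) = -(ν * (G * Real.exp (-(ν * s)))) := by
        ring
      rw [hB']
      generalize G * Real.exp (-(ν * s)) = B at *
      generalize (u s).1 = x at *
      have hyB : (u s).2 = B - k * x := by linarith
      have habs : |(u s).2| ≤ B + k * x := by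
        rw [hyB, abs_le]
        constructor <;> nlinarith
      generalize (u s).2 = y at *
      have hδ0 : 0 ≤ δ := (abs_nonneg y).trans hyδ
      -- the nonlinear terms of the second equation are bounded by `δ |ρ_n|`
      have h2 : -(c.b2 q * y ^ 2) ≤ |c.b2 q| * (δ * (B + k * x)) := by
        calc -(c.b2 q * y ^ 2) ≤ |c.b2 q * y ^ 2| := neg_le_abs _
          _ = |c.b2 q| * (|y| * |y|) := by rw [abs_mul, abs_pow, sq]
          _ ≤ |c.b2 q| * (δ * (B + k * x)) := by gcongr
      have h3 : -(c.b3 q * y ^ 3) ≤ |c.b3 q| * (δ * (B + k * x)) := by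
        calc -(c.b3 q * y ^ 3) ≤ |c.b3 q * y ^ 3| := neg_le_abs _
          _ = |c.b3 q| * (|y| * |y| * |y|) := by rw [abs_mul, abs_pow]; ring
          _ ≤ |c.b3 q| * (1 * δ * (B + k * x)) := by
              gcongr
              exact hyδ.trans hδ
          _ = _ := by ring
      have h4 : -(c.a1 q * y * x) ≤ c.a1 q * δ * x := by
        have : -y ≤ δ := (neg_le_abs y).trans hyδ
        nlinarith [mul_nonneg ha1.le hx0]
      have h5 : 0 ≤ c.a2 q * x ^ 2 := by positivity
      have h6 := mul_le_mul_of_nonneg_right hx hx0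
      have h7 := mul_lt_mul_of_pos_right hy hB
      have h8 : c.lam2 q * y = c.lam2 q * B - c.lam2 q * k * x := by rw [hyB]; ring
      nlinarith [mul_le_mul_of_nonneg_left h4 hk.le, mul_nonneg hk.le h5])
    t ht ()
  simpa [sub_neg] using key

/-- If `a₂/a₁ ≤ k < b₁/|λ₂|` and `λ₁ > 0`, then a solution with `ρ_s(0) > 0` cannot remain in a small
ball: there `ρ_n ≤ -k ρ_s` up to a vanishing error, so the growth rate of `ρ_s` is eventually at
least `λ₁ / 2`. -/
theorem IsSolution.exists_norm_gt (hu : c.IsSolution q φ u) (hq : q ∈ quadrant) (hφ : 0 < φ.1)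
    (hlam : 0 < c.lam1 q) {k ν δ : ℝ} (hk : 0 < k) (hν : 0 < ν) (hδ : δ ≤ 1)
    (hak : c.a2 q ≤ c.a1 q * k)
    (hx : k * (c.lam1 q + c.a1 q * δ + (|c.b2 q| + |c.b3 q|) * δ) ≤ c.lam2 q * k + c.b1 q)
    (hy : c.lam2 q + (|c.b2 q| + |c.b3 q|) * δ < -ν) :
    ∃ t, 0 ≤ t ∧ δ < ‖u t‖ := by
  by_contra! hball
  have ha1 := c.a1_pos q hq
  set G := |k * φ.1 + φ.2| + 1
  have hG : 0 < G := by positivity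
  have h0 : k * φ.1 + φ.2 < G := (le_abs_self _).trans_lt (lt_add_one _)
  have hlim : Tendsto (fun t => c.a1 q * (G * Real.exp (-(ν * t)))) atTop (𝓝 0) := by
    have := (Real.tendsto_exp_neg_atTop_nhds_zero.comp
      (tendsto_id.const_mul_atTop hν)).const_mul (c.a1 q * G)
    simpa [Function.comp_def, mul_assoc] using this
  refine hu.not_bounded_of_growthRate hφ (half_pos hlam) (C := δ) ?_ ?_
  · filter_upwards [hlim.eventually_lt_const (half_pos hlam), eventually_ge_atTop 0] with t ht ht0
    have h1 := hu.add_snd_lt_exp hq hk hδ hG hx hy hball h0 ht0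
    have h2 := mul_lt_mul_of_pos_left h1 ha1
    have h3 := mul_le_mul_of_nonneg_right hak (hu.fst_nonneg ht0)
    simp only [growthRate]
    nlinarith
  · filter_upwards [eventually_ge_atTop 0] with t ht
    exact (le_abs_self _).trans ((norm_fst_le (u t)).trans (hball t ht))

/-! ### Stability of the normal state -/

theorem solutionSatisfies_of_forall (hq : q ∈ quadrant) (hφ : φ ∈ stateSpace)
    {P : (ℝ → ℝ × ℝ) → Prop} (h : ∀ u, c.IsSolution q φ u → P u) : c.SolutionSatisfies q φ P :=
  ⟨exists_isSolution hq hφ, h⟩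

/-- The open rectangle `{|ρ_s| < r, |ρ_n| < k r}`. -/
def openRectangle (k r : ℝ) : Set (ℝ × ℝ) := {z | |z.1| < r ∧ |z.2| < k * r}

theorem isOpen_openRectangle (k r : ℝ) : IsOpen (openRectangle k r) :=
  (isOpen_lt continuous_fst.abs continuous_const).inter
    (isOpen_lt continuous_snd.abs continuous_const)

theorem zero_mem_openRectangle {k r : ℝ} (hk : 0 < k) (hr : 0 < r) :
    (0 : ℝ × ℝ) ∈ openRectangle k r := by
  simp [openRectangle, hr, mul_pos hk hr]

theorem IsSolution.norm_le_of_mem_openRectangle (hu : c.IsSolution q φ u) (hq : q ∈ quadrant)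
    {k ν e r : ℝ} (hk : 0 < k) (hν : 0 < ν) (he : 0 ≤ e) (her : e ≤ r) (hr : 0 < r)
    (hx : ∀ m, e ≤ m → m ≤ r → c.lam1 q + (c.a1 q * k - c.a2 q) * m < -ν)
    (hy : c.lam2 q * k + c.b1 q + |c.b2 q| * k ^ 2 * r < -(ν * k))
    (hφ : φ ∈ openRectangle k r) {t : ℝ} (ht : 0 ≤ t) :
    ‖u t‖ ≤ (1 + k) * (e + (r - e) * Real.exp (-(ν * t))) := by
  obtain ⟨h1, h2⟩ := hu.mem_shrinking_rectangle hq hk hν he her hr hx hy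
    ((le_abs_self _).trans_lt hφ.1) hφ.2 ht
  have h0 := hu.fst_nonneg ht
  have hB : 0 < e + (r - e) * Real.exp (-(ν * t)) := h0.trans_lt h1
  rw [Prod.norm_def, Real.norm_eq_abs, Real.norm_eq_abs, abs_of_nonneg h0]
  refine max_le ?_ ?_ <;> nlinarith

theorem tendsto_shrinking_bound {ν : ℝ} (hν : 0 < ν) (k e r : ℝ) :
    Tendsto (fun t => (1 + k) * (e + (r - e) * Real.exp (-(ν * t)))) atTop
      (𝓝 ((1 + k) * e)) := by
  have := Real.tendsto_exp_neg_atTop_nhds_zero.comp (tendsto_id.const_mul_atTop hν)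
  simpa [Function.comp_def] using ((this.const_mul (r - e)).const_add e).const_mul (1 + k)

/-- The normal state is stable where `λ₁, λ₂ < 0`: rectangles whose slope `k` exceeds `b₁/|λ₂|`
shrink to `0`. -/
theorem normalStateStable (hq : q ∈ quadrant) (hl1 : c.lam1 q < 0) (hl2 : c.lam2 q < 0) :
    c.NormalStateStable q := by
  have hb1 := c.b1_pos q hq
  obtain ⟨k, hk, hkl⟩ : ∃ k, 0 < k ∧ c.lam2 q * k + c.b1 q = c.lam2 q := by
    refine ⟨1 - c.b1 q / c.lam2 q, ?_, ?_⟩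
    · linarith [div_neg_of_pos_of_neg hb1 hl2]
    · rw [mul_sub, mul_div_cancel₀ _ hl2.ne]
      ring
  have hlim : ∀ {α : ℝ} (β : ℝ), α < 0 → ∀ᶠ s in 𝓝[>] (0 : ℝ), α + β * s < 0 := by
    intro α β hα
    have : Tendsto (fun s => α + β * s) (𝓝[>] (0 : ℝ)) (𝓝 (α + β * 0)) :=
      ((continuous_const.add (continuous_const.mul continuous_id)).tendsto 0).mono_left
        nhdsWithin_le_nhds
    exact this.eventually_lt_const (by simpa using hα)
  -- a single small number serves both as the size of the rectangle and as the rate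
  obtain ⟨r, ⟨hr1, hr2⟩, hr⟩ := (((hlim (|c.a1 q * k - c.a2 q| + 1) hl1).and
    (hlim (|c.b2 q| * k ^ 2 + k) hl2)).and self_mem_nhdsWithin).exists
  have hr : 0 < r := hr
  refine ⟨openRectangle k r, isOpen_openRectangle k r, zero_mem_openRectangle hk hr,
    fun ε hε => ?_⟩
  have hev := (tendsto_shrinking_bound hr k 0 r).eventually_lt_const
    (show (1 + k) * 0 < ε by simpa using hε)
  obtain ⟨t₀, ht₀⟩ := (hev.and (eventually_ge_atTop 0)).exists_forall_of_atTop
  refine ⟨t₀, (ht₀ t₀ le_rfl).2, fun φ hφ => solutionSatisfies_of_forall hq hφ.1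
    fun u hu t ht => ?_⟩
  refine (hu.norm_le_of_mem_openRectangle hq hk hr le_rfl hr.le hr (fun m hm0 hmr => ?_) ?_ hφ.2
    (ht₀ t ht).2).trans_lt (ht₀ t ht).1
  · have h1 : (c.a1 q * k - c.a2 q) * m ≤ |c.a1 q * k - c.a2 q| * r :=
      mul_le_mul (le_abs_self _) hmr hm0 (abs_nonneg _)
    linarith
  · linarith

/-- Where `λ₁ > 0` the normal state is unstable, since it attracts no solution with
`ρ_s(0) > 0`. -/
theorem not_normalStateStable (hq : q ∈ quadrant) (hl1 : 0 < c.lam1 q) :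
    ¬ c.NormalStateStable q := by
  rintro ⟨U, hU, h0U, h⟩
  have hcont : Continuous fun s : ℝ => ((s, 0) : ℝ × ℝ) := by fun_prop
  have hev : ∀ᶠ s : ℝ in 𝓝[>] 0, ((s, 0) : ℝ × ℝ) ∈ U :=
    ((hcont.tendsto 0).eventually (hU.mem_nhds h0U)).filter_mono nhdsWithin_le_nhds
  obtain ⟨s, hsU, hs⟩ := (hev.and self_mem_nhdsWithin).exists
  have hs : 0 < s := hs
  have hφ : ((s, 0) : ℝ × ℝ) ∈ stateSpace ∩ U := ⟨hs.le, hsU⟩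
  obtain ⟨u, hu⟩ := exists_isSolution (c := c) hq hφ.1
  refine hu.not_tendsto_zero hs hl1 (Metric.tendsto_atTop.2 fun ε hε => ?_)
  obtain ⟨t₀, -, ht₀⟩ := h ε hε
  exact ⟨t₀, fun t ht => by simpa using (ht₀ _ hφ).2 u hu t ht⟩

theorem D1_subset_quadrant (c : Coefficients) : c.D1 ⊆ quadrant := fun _ h => h.1

theorem D2_subset_quadrant (c : Coefficients) : c.D2 ⊆ quadrant := fun _ h => h.1

theorem hasSuperfluidTransition (hq₀ : q₀ ∈ quadrant) (hl2 : c.lam2 q₀ < 0)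
    (h1 : q₀ ∈ closure c.D1) (h2 : q₀ ∈ closure c.D2) : c.HasSuperfluidTransition q₀ := by
  refine ⟨h2, h1, ?_, ?_⟩
  · have := ((c.continuousOn_lam2 q₀ hq₀).mono c.D2_subset_quadrant).eventually_lt_const hl2
    filter_upwards [this, self_mem_nhdsWithin] with q hq hqD
    exact normalStateStable hqD.1 hqD.2 hq
  · filter_upwards [self_mem_nhdsWithin] with q hq
    exact ⟨not_normalStateStable hq.1 hq.2, fun φ hφ =>
      solutionSatisfies_of_forall hq.1 (le_of_lt hφ) fun u hu => hu.not_tendsto_zero hφ hq.2⟩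

/-! ### The type of the transition -/

theorem A_lt_zero_iff (c : Coefficients) (hl2 : c.lam2 q < 0) :
    c.A q < 0 ↔ c.a1 q * c.b1 q < c.a2 q * |c.lam2 q| := by
  rw [A, sub_neg, div_lt_iff₀ (abs_pos.2 hl2.ne)]

theorem A_pos_iff (c : Coefficients) (hl2 : c.lam2 q < 0) :
    0 < c.A q ↔ c.a2 q * |c.lam2 q| < c.a1 q * c.b1 q := by
  rw [A, sub_pos, lt_div_iff₀ (abs_pos.2 hl2.ne)]

theorem A_eq_zero_iff (c : Coefficients) (hl2 : c.lam2 q < 0) :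
    c.A q = 0 ↔ c.a1 q * c.b1 q = c.a2 q * |c.lam2 q| := by
  rw [A, sub_eq_zero, div_eq_iff (abs_pos.2 hl2.ne).ne']

theorem isOpenDenseIn_self {U : Set (ℝ × ℝ)} (hU : IsOpen U) : IsOpenDenseIn U U :=
  ⟨hU, Subset.rfl, subset_closure⟩

theorem isOpenDenseIn_inter_fst_pos {U : Set (ℝ × ℝ)} (hU : IsOpen U) :
    IsOpenDenseIn (U ∩ {z | 0 < z.1}) U := by
  refine ⟨hU.inter (isOpen_lt continuous_const continuous_fst), inter_subset_left, ?_⟩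
  rintro z ⟨hz, hzU⟩
  have hcont : Continuous fun s : ℝ => z + ((s, 0) : ℝ × ℝ) := by fun_prop
  have hlim : Tendsto (fun s : ℝ => z + ((s, 0) : ℝ × ℝ)) (𝓝[>] 0) (𝓝 z) := by
    have h := hcont.tendsto 0
    rw [Prod.mk_zero_zero, add_zero] at h
    exact h.mono_left nhdsWithin_le_nhds
  refine mem_closure_of_tendsto hlim ?_
  filter_upwards [hlim.eventually (hU.mem_nhds hzU), self_mem_nhdsWithin] with s hs hs0
  have hz : 0 ≤ z.1 := hz
  have hpos : 0 < (z + ((s, 0) : ℝ × ℝ)).1 := by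
    have : 0 < s := hs0
    simp only [Prod.fst_add]
    linarith
  exact ⟨hpos.le, hs, hpos⟩

/-- For `A < 0` there is a slope `k` with `b₁/|λ₂| < k < a₂/a₁`. Near `q₀`, a fixed rectangle of
slope `k` then shrinks to one whose size is controlled by `λ₁`. -/
theorem isContinuousAt_of_A_neg (hq₀ : q₀ ∈ quadrant) (hl1 : c.lam1 q₀ = 0)
    (hl2 : c.lam2 q₀ < 0) (hA : c.A q₀ < 0) : c.IsContinuousAt q₀ := by
  have ha1 := c.a1_pos q₀ hq₀
  have ha2 := c.a2_pos q₀ hq₀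
  have hb1 := c.b1_pos q₀ hq₀
  rw [A_lt_zero_iff c hl2, abs_of_neg hl2] at hA
  obtain ⟨k, hk1, hk2⟩ : ∃ k, c.b1 q₀ / -c.lam2 q₀ < k ∧ k < c.a2 q₀ / c.a1 q₀ := by
    refine exists_between ?_
    rw [div_lt_div_iff₀ (neg_pos.2 hl2) ha1]
    linarith
  have hk : 0 < k := (div_pos hb1 (neg_pos.2 hl2)).trans hk1
  rw [div_lt_iff₀ (neg_pos.2 hl2)] at hk1
  rw [lt_div_iff₀ ha1] at hk2
  obtain ⟨d, hd, hd'⟩ : ∃ d, 0 < d ∧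
      d < min (c.a2 q₀ - c.a1 q₀ * k) (-(c.lam2 q₀ * k + c.b1 q₀)) :=
    exists_between (lt_min (by linarith) (by linarith))
  rw [lt_min_iff] at hd'
  obtain ⟨r, hr, hrd⟩ : ∃ r, 0 < r ∧ (|c.b2 q₀| + 1) * k ^ 2 * r ≤ d / 2 :=
    ⟨d / 2 / ((|c.b2 q₀| + 1) * k ^ 2), by positivity, by rw [mul_div_cancel₀ _ (by positivity)]⟩
  refine ⟨openRectangle k r, isOpen_openRectangle k r, zero_mem_openRectangle hk hr,
    fun _ => openRectangle k r, fun q _ => isOpenDenseIn_self (isOpen_openRectangle k r),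
    fun ε hε => ?_⟩
  obtain ⟨e, he, he'⟩ : ∃ e, 0 < e ∧ e < min r (ε / (1 + k)) :=
    exists_between (lt_min hr (by positivity))
  rw [lt_min_iff, lt_div_iff₀ (by positivity)] at he'
  obtain ⟨ν, hν, hν'⟩ : ∃ ν, 0 < ν ∧ ν < min (d * e / 2) (d / (2 * k)) :=
    exists_between (by positivity)
  rw [lt_min_iff, lt_div_iff₀ zero_lt_two, lt_div_iff₀ (by positivity : 0 < 2 * k)] at hν'
  have c1 := c.continuousOn_lam1 q₀ hq₀
  have c2 : ContinuousWithinAt (fun q => c.a2 q - c.a1 q * k) quadrant q₀ :=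
    (c.continuousOn_a2 q₀ hq₀).sub ((c.continuousOn_a1 q₀ hq₀).mul_const k)
  have c3 : ContinuousWithinAt (fun q => -(c.lam2 q * k + c.b1 q)) quadrant q₀ :=
    (((c.continuousOn_lam2 q₀ hq₀).mul_const k).add (c.continuousOn_b1 q₀ hq₀)).neg
  have c4 := (c.continuousOn_b2 q₀ hq₀).abs
  filter_upwards [c1.eventually_lt_const (show c.lam1 q₀ < d * e / 2 by rw [hl1]; positivity),
    c2.eventually_const_lt hd'.1, c3.eventually_const_lt hd'.2,
    c4.eventually_lt_const (lt_add_one _), self_mem_nhdsWithin] with q h1 h2 h3 h4 hq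
  refine fun φ hφ => solutionSatisfies_of_forall hq hφ.1 fun u hu => ?_
  refine limsup_le_of_le (by isBoundedDefault) ?_
  filter_upwards [(tendsto_shrinking_bound hν k e r).eventually_lt_const
    (show (1 + k) * e < ε by linarith), eventually_ge_atTop 0] with t ht ht0
  rw [← ofReal_norm]
  refine ENNReal.ofReal_le_ofReal ((hu.norm_le_of_mem_openRectangle hq hk hν he.le he'.1.le hr
    (fun m hm _ => ?_) ?_ hφ.2 ht0).trans ht.le)
  · have : d * e ≤ (c.a2 q - c.a1 q * k) * m := mul_le_mul h2.le hm he.le (hd.trans h2).le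
    linarith
  · have : |c.b2 q| * k ^ 2 * r ≤ (|c.b2 q₀| + 1) * k ^ 2 * r := by gcongr
    linarith

/-- For `A > 0` there is a slope `k` with `a₂/a₁ < k < b₁/|λ₂|`, so that for `q ∈ D₁` near `q₀`
solutions with `ρ_s(0) > 0` repeatedly leave a ball of fixed size `δ`. -/
theorem isJumpAt_of_A_pos (hq₀ : q₀ ∈ quadrant) (hl1 : c.lam1 q₀ = 0)
    (hl2 : c.lam2 q₀ < 0) (hA : 0 < c.A q₀) : c.IsJumpAt q₀ := by
  have ha1 := c.a1_pos q₀ hq₀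
  have ha2 := c.a2_pos q₀ hq₀
  rw [A_pos_iff c hl2, abs_of_neg hl2] at hA
  obtain ⟨k, hk1, hk2⟩ : ∃ k, c.a2 q₀ / c.a1 q₀ < k ∧ k < c.b1 q₀ / -c.lam2 q₀ := by
    refine exists_between ?_
    rw [div_lt_div_iff₀ ha1 (neg_pos.2 hl2)]
    linarith
  have hk : 0 < k := (div_pos ha2 ha1).trans hk1
  rw [div_lt_iff₀ ha1] at hk1
  rw [lt_div_iff₀ (neg_pos.2 hl2)] at hk2
  have hlim : ∀ {β γ : ℝ} (α : ℝ), β < γ → ∀ᶠ δ in 𝓝[>] (0 : ℝ), α * δ + β < γ := by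
    intro β γ α h
    have : Tendsto (fun δ => α * δ + β) (𝓝[>] (0 : ℝ)) (𝓝 (α * 0 + β)) :=
      (((continuous_const.mul continuous_id).add continuous_const).tendsto 0).mono_left
        nhdsWithin_le_nhds
    exact this.eventually_lt_const (by simpa using h)
  obtain ⟨δ, ⟨⟨hδ1, hδx⟩, hδy⟩, hδ⟩ := ((((hlim 1 (zero_lt_one' ℝ)).and
    (hlim (k * (c.a1 q₀ + (|c.b2 q₀| + |c.b3 q₀|)))
      (show 0 < c.lam2 q₀ * k + c.b1 q₀ by linarith))).and
    (hlim (|c.b2 q₀| + |c.b3 q₀|) (show c.lam2 q₀ < c.lam2 q₀ / 2 by linarith))).and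
      self_mem_nhdsWithin).exists
  have hδ : 0 < δ := hδ
  refine ⟨univ, isOpen_univ, mem_univ _, δ, hδ, ?_⟩
  have cN : ContinuousWithinAt (fun q => (|c.b2 q| + |c.b3 q|) * δ) quadrant q₀ :=
    ((c.continuousOn_b2 q₀ hq₀).abs.add (c.continuousOn_b3 q₀ hq₀).abs).mul_const δ
  have c1 : ContinuousWithinAt (fun q => c.a1 q * k - c.a2 q) quadrant q₀ :=
    ((c.continuousOn_a1 q₀ hq₀).mul_const k).sub (c.continuousOn_a2 q₀ hq₀)
  have c2 : ContinuousWithinAt (fun q => c.lam2 q * k + c.b1 q -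
      k * (c.lam1 q + c.a1 q * δ + (|c.b2 q| + |c.b3 q|) * δ)) quadrant q₀ :=
    (((c.continuousOn_lam2 q₀ hq₀).mul_const k).add (c.continuousOn_b1 q₀ hq₀)).sub
      ((((c.continuousOn_lam1 q₀ hq₀).add ((c.continuousOn_a1 q₀ hq₀).mul_const δ)).add
        cN).const_mul k)
  have c3 : ContinuousWithinAt (fun q => c.lam2 q + (|c.b2 q| + |c.b3 q|) * δ) quadrant q₀ :=
    (c.continuousOn_lam2 q₀ hq₀).add cN
  filter_upwards [(c1.mono c.D1_subset_quadrant).eventually_const_lt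
      (show 0 < c.a1 q₀ * k - c.a2 q₀ by linarith),
    (c2.mono c.D1_subset_quadrant).eventually_const_lt (show 0 < c.lam2 q₀ * k + c.b1 q₀ -
      k * (c.lam1 q₀ + c.a1 q₀ * δ + (|c.b2 q₀| + |c.b3 q₀|) * δ) by rw [hl1]; linarith),
    (c3.mono c.D1_subset_quadrant).eventually_lt_const
      (show c.lam2 q₀ + (|c.b2 q₀| + |c.b3 q₀|) * δ < c.lam2 q₀ / 2 by linarith),
    self_mem_nhdsWithin] with q h1 h2 h3 hq
  refine ⟨_, isOpenDenseIn_inter_fst_pos isOpen_univ, fun φ hφ =>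
    solutionSatisfies_of_forall hq.1 hφ.1 fun u hu => ?_⟩
  have hφ0 : 0 < φ.1 := hφ.2.2
  by_contra! hlt
  obtain ⟨T, hT⟩ := ((eventually_lt_of_limsup_lt hlt).and
    (eventually_ge_atTop 0)).exists_forall_of_atTop
  have hT0 : 0 ≤ T := (hT T le_rfl).2
  obtain ⟨t, ht, hgt⟩ := (hu.shift hT0).exists_norm_gt hq.1 (hu.fst_pos hφ0 hT0) hq.2 hk
    (ν := -(c.lam2 q₀ / 2)) (by linarith) (by linarith : δ ≤ 1) (by linarith) (by linarith)
    (by linarith)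
  have hsmall := (hT (t + T) (by linarith)).1
  rw [← ofReal_norm] at hsmall
  exact absurd (ENNReal.ofReal_le_ofReal hgt.le) (not_le.2 hsmall)

/-- The two types exclude each other: two dense open sets of initial states near `0` have a point
in common. -/
theorem not_isContinuousAt_and_isJumpAt (h1 : q₀ ∈ closure c.D1) (hI : c.IsContinuousAt q₀)
    (hJ : c.IsJumpAt q₀) : False := by
  obtain ⟨U, -, h0U, V, hV, hlow⟩ := hI
  obtain ⟨U', hU', h0U', δ, hδ, hhigh⟩ := hJ
  have : (𝓝[c.D1] q₀).NeBot := mem_closure_iff_nhdsWithin_neBot.1 h1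
  obtain ⟨q, ⟨hq1, V', hV', hq2⟩, hqD⟩ :=
    ((((hlow (δ / 2) (half_pos hδ)).filter_mono (nhdsWithin_mono q₀ c.D1_subset_quadrant)).and
      hhigh).and self_mem_nhdsWithin).exists
  have h0 : (0 : ℝ × ℝ) ∈ stateSpace := le_refl (0 : ℝ)
  obtain ⟨φ₁, hφ₁U', hφ₁S, hφ₁V⟩ := mem_closure_iff.1
    ((hV q hqD.1).2.2 ⟨h0, h0U⟩) U' hU' h0U'
  obtain ⟨φ, hφV, hφS, hφV'⟩ := mem_closure_iff.1 (hV'.2.2 ⟨hφ₁S, hφ₁U'⟩) _ (hV q hqD.1).1 hφ₁V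
  obtain ⟨⟨u, hu⟩, hle⟩ := hq1 φ ⟨hφS, hφV⟩
  have := ((hq2 φ ⟨hφS, hφV'⟩).2 u hu).trans (hle u hu)
  rw [ENNReal.ofReal_le_ofReal_iff (by positivity)] at this
  linarith

theorem hasTypeITransition (hq₀ : q₀ ∈ quadrant) (hl1 : c.lam1 q₀ = 0) (hl2 : c.lam2 q₀ < 0)
    (h1 : q₀ ∈ closure c.D1) (h2 : q₀ ∈ closure c.D2) (hA : c.A q₀ < 0) :
    c.HasTypeITransition q₀ :=
  ⟨hasSuperfluidTransition hq₀ hl2 h1 h2, isContinuousAt_of_A_neg hq₀ hl1 hl2 hA⟩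

theorem hasTypeIITransition (hq₀ : q₀ ∈ quadrant) (hl1 : c.lam1 q₀ = 0) (hl2 : c.lam2 q₀ < 0)
    (h1 : q₀ ∈ closure c.D1) (h2 : q₀ ∈ closure c.D2) (hA : 0 < c.A q₀) :
    c.HasTypeIITransition q₀ :=
  ⟨hasSuperfluidTransition hq₀ hl2 h1 h2, isJumpAt_of_A_pos hq₀ hl1 hl2 hA⟩

/-! ### Switch points on the coexistence curve -/

/-- The continuous function `a₁b₁ - a₂|λ₂|` on a parametrized curve. It has the sign of `A` where
`λ₂ < 0`, but is also meaningful at the end `C`, where `λ₂ = 0`. -/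
def signFunction (c : Coefficients) (γ : ℝ → ℝ × ℝ) (s : ℝ) : ℝ :=
  c.a1 (γ s) * c.b1 (γ s) - c.a2 (γ s) * |c.lam2 (γ s)|

namespace IsCurveCB

variable {γ : ℝ → ℝ × ℝ}

theorem continuousOn_signFunction (hγ : c.IsCurveCB γ) :
    ContinuousOn (c.signFunction γ) (Icc 0 1) :=
  ((c.continuousOn_a1.comp hγ.continuousOn hγ.mapsTo).mul
    (c.continuousOn_b1.comp hγ.continuousOn hγ.mapsTo)).sub
    ((c.continuousOn_a2.comp hγ.continuousOn hγ.mapsTo).mul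
      (c.continuousOn_lam2.comp hγ.continuousOn hγ.mapsTo).abs)

theorem signFunction_zero_pos (hγ : c.IsCurveCB γ) : 0 < c.signFunction γ 0 := by
  have h := hγ.mapsTo (left_mem_Icc.2 zero_le_one)
  simpa [signFunction, hγ.lam2_eq_zero] using mul_pos (c.a1_pos _ h) (c.b1_pos _ h)

theorem A_pos_iff (hγ : c.IsCurveCB γ) {s : ℝ} (hs : s ∈ Ioc (0 : ℝ) 1) :
    0 < c.A (γ s) ↔ 0 < c.signFunction γ s := by
  rw [Coefficients.A_pos_iff c (hγ.lam2_neg s hs), signFunction, sub_pos]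

theorem A_lt_zero_iff (hγ : c.IsCurveCB γ) {s : ℝ} (hs : s ∈ Ioc (0 : ℝ) 1) :
    c.A (γ s) < 0 ↔ c.signFunction γ s < 0 := by
  rw [Coefficients.A_lt_zero_iff c (hγ.lam2_neg s hs), signFunction, sub_neg]

theorem A_eq_zero_iff (hγ : c.IsCurveCB γ) {s : ℝ} (hs : s ∈ Ioc (0 : ℝ) 1) :
    c.A (γ s) = 0 ↔ c.signFunction γ s = 0 := by
  rw [Coefficients.A_eq_zero_iff c (hγ.lam2_neg s hs), signFunction, sub_eq_zero]

theorem hasTypeITransition (hγ : c.IsCurveCB γ) {s : ℝ} (hs : s ∈ Ioc (0 : ℝ) 1)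
    (h : c.signFunction γ s < 0) : c.HasTypeITransition (γ s) :=
  have hs' := Ioc_subset_Icc_self hs
  Coefficients.hasTypeITransition (hγ.mapsTo hs') (hγ.lam1_eq_zero s hs') (hγ.lam2_neg s hs)
    (hγ.mem_closure_D1 s hs) (hγ.mem_closure_D2 s hs) ((hγ.A_lt_zero_iff hs).2 h)

theorem hasTypeIITransition (hγ : c.IsCurveCB γ) {s : ℝ} (hs : s ∈ Ioc (0 : ℝ) 1)
    (h : 0 < c.signFunction γ s) : c.HasTypeIITransition (γ s) :=
  have hs' := Ioc_subset_Icc_self hs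
  Coefficients.hasTypeIITransition (hγ.mapsTo hs') (hγ.lam1_eq_zero s hs') (hγ.lam2_neg s hs)
    (hγ.mem_closure_D1 s hs) (hγ.mem_closure_D2 s hs) ((hγ.A_pos_iff hs).2 h)

/-- At a switch point `A` vanishes: a nonzero sign would persist on both sides and give one of
the neighboring points transitions of both types. -/
theorem A_eq_zero_of_isSwitchPoint (hγ : c.IsCurveCB γ) {s : ℝ} (hs : c.IsSwitchPoint γ s) :
    c.A (γ s) = 0 := by
  obtain ⟨hs01, hII, hI⟩ := hs
  have hsI : s ∈ Ioc (0 : ℝ) 1 := Ioo_subset_Ioc_self hs01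
  have hcont : ContinuousAt (c.signFunction γ) s :=
    hγ.continuousOn_signFunction.continuousAt (Icc_mem_nhds hs01.1 hs01.2)
  rw [hγ.A_eq_zero_iff hsI]
  rcases lt_trichotomy (c.signFunction γ s) 0 with h | h | h
  · exfalso
    obtain ⟨r, hr, hrI⟩ := (((hcont.eventually_lt_const h).filter_mono nhdsWithin_le_nhds).and
      (Ioo_mem_nhdsLT hs01.1)).exists
    have hr' : r ∈ Ioc (0 : ℝ) 1 := ⟨hrI.1, (hrI.2.trans hs01.2).le⟩
    exact not_isContinuousAt_and_isJumpAt (hγ.mem_closure_D1 r hr')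
      (hγ.hasTypeITransition hr' hr).2 (hII r hrI).2
  · exact h
  · exfalso
    obtain ⟨r, hr, hrI⟩ := (((hcont.eventually_const_lt h).filter_mono nhdsWithin_le_nhds).and
      (Ioc_mem_nhdsGT hs01.2)).exists
    have hr' : r ∈ Ioc (0 : ℝ) 1 := ⟨hs01.1.trans hrI.1, hrI.2⟩
    exact not_isContinuousAt_and_isJumpAt (hγ.mem_closure_D1 r hr') (hI r hrI).2
      (hγ.hasTypeIITransition hr' hr).2

end IsCurveCB

end Coefficients

theorem theorem4p2 (c : Coefficients) :
    -- the transition at `(T₀, p₀)` and its type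
    (∀ q₀ ∈ quadrant, c.lam1 q₀ = 0 → c.lam2 q₀ < 0 →
      q₀ ∈ closure c.D1 → q₀ ∈ closure c.D2 →
        c.HasSuperfluidTransition q₀ ∧
        (c.A q₀ < 0 → c.HasTypeITransition q₀) ∧
        (0 < c.A q₀ → c.HasTypeIITransition q₀)) ∧
    -- the switch point on the curve `CB`, when `a₁b₁` is small against `a₂` at `B`
    (∀ γ : ℝ → ℝ × ℝ, c.IsCurveCB γ →
      c.a1 (γ 1) * c.b1 (γ 1) < c.a2 (γ 1) * |c.lam2 (γ 1)| →
        -- the first and the last solution of `A = 0` on `CB`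
        (∃ s₁ s₂ : ℝ, 0 < s₁ ∧ s₁ ≤ s₂ ∧ s₂ < 1 ∧ c.A (γ s₁) = 0 ∧ c.A (γ s₂) = 0 ∧
          (∀ s ∈ Ioo 0 s₁, 0 < c.A (γ s) ∧ c.HasTypeIITransition (γ s)) ∧
          (∀ s ∈ Ioc s₂ 1, c.A (γ s) < 0 ∧ c.HasTypeITransition (γ s))) ∧
        -- a switch point solves `A = 0`
        (∀ s, c.IsSwitchPoint γ s → c.A (γ s) = 0) ∧
        -- if the equation `A = 0` determines a single point of `CB`, it is a switch point
        (∀ s ∈ Ioc (0 : ℝ) 1, c.A (γ s) = 0 →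
          (∀ r ∈ Ioc (0 : ℝ) 1, c.A (γ r) = 0 → r = s) → c.IsSwitchPoint γ s)) := by 
  refine ⟨fun q₀ hq₀ hl1 hl2 h1 h2 => ⟨Coefficients.hasSuperfluidTransition hq₀ hl2 h1 h2,
    Coefficients.hasTypeITransition hq₀ hl1 hl2 h1 h2,
    Coefficients.hasTypeIITransition hq₀ hl1 hl2 h1 h2⟩, fun γ hγ hB => ?_⟩
  obtain ⟨s₁, s₂, hs₁, hs₁₂, hs₂, hz₁, hz₂, hpos, hneg⟩ :=
    exists_first_last_zero hγ.continuousOn_signFunction hγ.signFunction_zero_pos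
      (sub_neg.2 hB)
  have hI₁ : s₁ ∈ Ioc (0 : ℝ) 1 := ⟨hs₁, (hs₁₂.trans_lt hs₂).le⟩
  have hI₂ : s₂ ∈ Ioc (0 : ℝ) 1 := ⟨hs₁.trans_le hs₁₂, hs₂.le⟩
  have hbefore : ∀ s ∈ Ioo 0 s₁, s ∈ Ioc (0 : ℝ) 1 := fun s hs => ⟨hs.1, hs.2.le.trans hI₁.2⟩
  have hafter : ∀ s ∈ Ioc s₂ 1, s ∈ Ioc (0 : ℝ) 1 := fun s hs => ⟨hI₂.1.trans hs.1, hs.2⟩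
  refine ⟨⟨s₁, s₂, hs₁, hs₁₂, hs₂, (hγ.A_eq_zero_iff hI₁).2 hz₁, (hγ.A_eq_zero_iff hI₂).2 hz₂,
    fun s hs => ⟨(hγ.A_pos_iff (hbefore s hs)).2 (hpos s hs),
      hγ.hasTypeIITransition (hbefore s hs) (hpos s hs)⟩,
    fun s hs => ⟨(hγ.A_lt_zero_iff (hafter s hs)).2 (hneg s hs),
      hγ.hasTypeITransition (hafter s hs) (hneg s hs)⟩⟩,
    fun s hs => hγ.A_eq_zero_of_isSwitchPoint hs, fun s hs _ huniq => ?_⟩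
  obtain rfl := huniq s₁ hI₁ ((hγ.A_eq_zero_iff hI₁).2 hz₁)
  obtain rfl := huniq s₂ hI₂ ((hγ.A_eq_zero_iff hI₂).2 hz₂)
  exact ⟨⟨hs.1, hs₂⟩, fun r hr => hγ.hasTypeIITransition (hbefore r hr) (hpos r hr),
    fun r hr => hγ.hasTypeITransition (hafter r hr) (hneg r hr)⟩
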